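/- Let $n$ be a number of qubits. For $1\le k\le n$ let $Z_k$ and $P_k$ denote the Pauli matrices $\sigma_z$ and $\sigma_x$ acting on the $k$-th qubit, as $2^n\times 2^n$ matrices in the computational basis, and put $Z_0=I$. For real coefficients $\beta=(\beta_{kl})_{0\le k,l\le n}$ let $$H_Z(\beta)=\sum_{0\le k,l\le n}\beta_{kl}Z_kZ_l ,$$ so that $H_Z(\beta)$ consists of first- and second-order products of the $Z_k$ over all pairs (together with multiples of the identity). Let $H_X$ be the uniform sum $\sum_{k=1}^nP_k$, or any other path-connected Hamiltonian on the computational basis, i.e. any Hermitian $2^n\times 2^n$ matrix $H$ for which the graph on the computational basis vectors, in which two distinct vectors $e_i,e_j$ are joined when $H_{ij}\neq0$, is connected. Then the QAOA ansatz generated by $H_X$ and $H_Z$ is universal: the set of all finite alternating products $$e^{-iH_Z(\beta^{(1)})}e^{-i\gamma_1H_X}\,e^{-iH_Z(\beta^{(2)})}e^{-i\gamma_2H_X}\cdots e^{-iH_Z(\beta^{(p)})}e^{-i\gamma_pH_X},$$ with $p\ge0$ and real parameters $\beta^{(j)}_{kl}$, $\gamma_j$, is dense in $\mathrm U(2^n)$.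 -/

import Mathlib

open scoped Matrix

noncomputable section

namespace QAOA

/-- Computational basis labels (bit strings) of `n` qubits. -/
abbrev Bits (n : ℕ) : Type := Fin n → Fin 2

/-- Operators on the `2 ^ n`-dimensional space of `n` qubits, as matrices in the computational
basis. -/
abbrev Op (n : ℕ) : Type := Matrix (Bits n) (Bits n) ℂ

/-- The Pauli matrix `X`. -/
def pauliX : Matrix (Fin 2) (Fin 2) ℂ := !![0, 1; 1, 0]

/-- The Pauli matrix `Z`. -/
def pauliZ : Matrix (Fin 2) (Fin 2) ℂ := !![1, 0; 0, -1]

/-- The tensor product `A 0 ⊗ A 1 ⊗ ⋯ ⊗ A (n - 1)` of single-qubit operators, in the computational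
basis. -/
def tensor {n : ℕ} (A : Fin n → Matrix (Fin 2) (Fin 2) ℂ) : Op n :=
  Matrix.of fun s t => ∏ j, A j (s j) (t j)

/-- The operator `I ⊗ ⋯ ⊗ I ⊗ A ⊗ I ⊗ ⋯ ⊗ I`, with `A` acting on qubit `k`. -/
def onQubit {n : ℕ} (k : Fin n) (A : Matrix (Fin 2) (Fin 2) ℂ) : Op n :=
  tensor (Function.update (fun _ => 1) k A)

/-- The uniform sum of the Pauli `X` operators over all qubits. -/
def sumX (n : ℕ) : Op n := ∑ k : Fin n, onQubit k pauliX

/-- `Z_0 = I`, and for `1 ≤ k ≤ n`, `Z_k` is Pauli `Z` on the `k`-th qubit. The index `0` makes the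
first-order terms `Z_k = Z_0 Z_k` (and the identity `Z_0 Z_0`) instances of the products
`Z_k Z_l`. -/
def opZ (n : ℕ) : Fin (n + 1) → Op n :=
  Fin.cons 1 fun k => onQubit k pauliZ

/-- `H_Z = ∑_{k,l} β_{kl} Z_k Z_l`, consisting of first- and second-order products of the
Pauli `Z` operators, over all pairs of indices. -/
def hamZ {n : ℕ} (β : Fin (n + 1) → Fin (n + 1) → ℝ) : Op n :=
  ∑ k, ∑ l, (β k l : ℂ) • (opZ n k * opZ n l)

/-- The index graph of a matrix: distinct basis labels are joined when the corresponding
off-diagonal entry is nonzero. -/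
def indexGraph {ι : Type*} (H : Matrix ι ι ℂ) : SimpleGraph ι :=
  SimpleGraph.fromRel fun i j => H i j ≠ 0

/-- A path-connected Hamiltonian: a Hermitian matrix whose index graph is connected. -/
def IsPathConnectedHamiltonian {ι : Type*} (H : Matrix ι ι ℂ) : Prop :=
  H.IsHermitian ∧ (indexGraph H).Connected

/-- One layer `exp(-i H_Z) exp(-i γ H)` with real parameters `β` (those of `H_Z`) and `γ`. -/
def layer {n : ℕ} (H : Op n) (θ : (Fin (n + 1) → Fin (n + 1) → ℝ) × ℝ) : Op n :=
  NormedSpace.exp (-Complex.I • hamZ θ.1) * NormedSpace.exp ((-Complex.I * (θ.2 : ℂ)) • H)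

/-- The QAOA ansatz with mixer `H`: all unitaries that are finite alternating products
`exp(-i H_Z) exp(-i γ H) exp(-i H_Z') exp(-i γ' H) ⋯`, with any number of layers and any real
parameters in each layer. -/
def ansatz {n : ℕ} (H : Op n) : Set (Matrix.unitaryGroup (Bits n) ℂ) :=
  {U | ∃ θs : List ((Fin (n + 1) → Fin (n + 1) → ℝ) × ℝ),
    (U : Op n) = (θs.map (layer H)).prod}

end QAOA

end

/-!
The closure `G` of the monoid of products of layers is a closed monoid of matrices, and everything
is read off from its tangent space: the skew-Hermitian `x` with `exp (t x) ∈ G` for all real `t`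
(`tangentSpace`). The Lie product formula makes it a real vector space, and differentiating
`exp (t x) y exp (-t x)` makes it closed under commutators. It contains `i H_Z(β)` for every `β`
and `i H`, because `H_Z(0) = 0` and `exp (0 H) = 1` let a layer use either generator alone.

In the computational basis `H_Z(β)` is diagonal, with entries quadratic in the spins. Quadratic
energies tell gaps apart: if `s ≠ t` and the pair `{u, v}` differs from `{s, t}`, then some `β` has
different squared gaps at the two pairs (`separatesGaps_energy`). Since `ad_D` multiplies the entry
at `(u, v)` by `i (d_u - d_v)`, suitable products of operators `ad_D ^ 2 + c` cut `i H` down to the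
single edge `{s, t}`, for every edge of its index graph, and one more `ad_D` rotates the phase of
that entry (`skewUnit_mem_of_apply_ne_zero`). Commutators of adjacent edges compose them, so by
connectedness all `z E_st - z̄ E_ts` with `s ≠ t` are reached; their commutators give the
`i (E_ss - E_tt)`, and with the scalar `i` every skew-Hermitian matrix (`mem_of_mem_skewAdjoint`).

A unitary matrix has finite spectrum, so a phase moves it away from the eigenvalue `-1` and it is a
phase times an exponential (`exists_unitary_eq_exp_mul_exp`). Hence every unitary lies in `G`. The
uniform sum of the Pauli `X` operators is the case where the index graph is the hypercube.
-/

namespace QAOA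

/-! ### The Lie algebra of a closed monoid in a C⋆-algebra -/

section TangentSpace

open Filter Topology NormedSpace

variable {A : Type*} [CStarAlgebra A]

theorem norm_pow_sub_pow_le_of_mem_unitary {x y : A} (hx : x ∈ unitary A) (hy : y ∈ unitary A)
    (n : ℕ) : ‖x ^ n - y ^ n‖ ≤ n * ‖x - y‖ := by
  induction n with
  | zero => simp
  | succ n ih =>
    calc ‖x ^ (n + 1) - y ^ (n + 1)‖ = ‖x ^ n * (x - y) + (x ^ n - y ^ n) * y‖ := by
          congr 1; rw [pow_succ, pow_succ]; noncomm_ring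
      _ ≤ ‖x ^ n * (x - y)‖ + ‖(x ^ n - y ^ n) * y‖ := norm_add_le _ _
      _ = ‖x - y‖ + ‖x ^ n - y ^ n‖ := by
          rw [CStarRing.norm_mem_unitary_mul _ (pow_mem hx n), CStarRing.norm_mul_mem_unitary _ hy]
      _ ≤ ‖x - y‖ + n * ‖x - y‖ := by gcongr
      _ = ((n + 1 : ℕ) : ℝ) * ‖x - y‖ := by push_cast; ring

theorem hasDerivAt_exp_smul_zero (x : A) :
    HasDerivAt (fun t : ℝ => exp (t • x)) x 0 := by
  simpa using hasDerivAt_exp_smul_const (𝕂 := ℝ) x 0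

theorem exp_real_smul_mem_unitary {x : A} (hx : x ∈ skewAdjoint A) (t : ℝ) :
    exp (t • x) ∈ unitary A := by
  let _ := NormedAlgebra.restrictScalars ℚ ℂ A
  exact exp_mem_unitary_of_mem_skewAdjoint (skewAdjoint.smul_mem t hx)

theorem exp_inv_natCast_smul_pow (x : A) {n : ℕ} (hn : n ≠ 0) (t : ℝ) :
    exp ((t / n) • x) ^ n = exp (t • x) := by
  let _ := NormedAlgebra.restrictScalars ℚ ℂ A
  rw [← exp_nsmul, ← Nat.cast_smul_eq_nsmul ℝ, smul_smul, mul_div_cancel₀]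
  exact_mod_cast hn

/-- The Lie product formula for skew-adjoint elements. The two `n`-th roots agree to first order in
`1 / n`, and taking `n`-th powers of unitaries multiplies their distance by at most `n`. -/
theorem tendsto_exp_mul_exp_pow {x y : A} (hx : x ∈ skewAdjoint A) (hy : y ∈ skewAdjoint A) :
    Tendsto (fun n : ℕ => (exp ((1 / (n : ℝ)) • x) * exp ((1 / (n : ℝ)) • y)) ^ n) atTop
      (𝓝 (exp (x + y))) := by
  have hd : HasDerivAt (fun t : ℝ => exp (t • x) * exp (t • y) - exp (t • (x + y))) 0 0 := by
    have h := ((hasDerivAt_exp_smul_zero x).fun_mul (hasDerivAt_exp_smul_zero y)).fun_sub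
      (hasDerivAt_exp_smul_zero (x + y))
    simpa using h
  have hlim : Tendsto (fun n : ℕ => (n : ℝ) * ‖exp ((1 / (n : ℝ)) • x) * exp ((1 / (n : ℝ)) • y)
      - exp ((1 / (n : ℝ)) • (x + y))‖) atTop (𝓝 0) := by
    have h0 : Tendsto (fun n : ℕ => 1 / (n : ℝ)) atTop (𝓝[≠] 0) := by
      refine tendsto_nhdsWithin_iff.2 ⟨tendsto_one_div_atTop_nhds_zero_nat, ?_⟩
      filter_upwards [eventually_ne_atTop 0] with n hn
      simpa using hn
    have h := ((hasDerivAt_iff_tendsto_slope.1 hd).comp h0).norm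
    rw [norm_zero] at h
    refine h.congr fun n => ?_
    simp [slope_def_module, norm_smul]
  rw [tendsto_iff_norm_sub_tendsto_zero]
  refine squeeze_zero' (Eventually.of_forall fun n => norm_nonneg _) ?_ hlim
  filter_upwards [eventually_ne_atTop 0] with n hn
  have h1 : exp (x + y) = exp ((1 / (n : ℝ)) • (x + y)) ^ n := by
    rw [exp_inv_natCast_smul_pow _ hn, one_smul]
  rw [h1]
  exact norm_pow_sub_pow_le_of_mem_unitary
    (mul_mem (exp_real_smul_mem_unitary hx _) (exp_real_smul_mem_unitary hy _))
    (exp_real_smul_mem_unitary (add_mem hx hy) _) n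

/-- The tangent space at `1` of a closed submonoid `G` of a C⋆-algebra: the skew-adjoint elements
whose one-parameter group lies in `G`. -/
def tangentSpace (G : Submonoid A) (hG : IsClosed (G : Set A)) : Submodule ℝ A where
  carrier := {x | x ∈ skewAdjoint A ∧ ∀ t : ℝ, exp (t • x) ∈ G}
  zero_mem' := ⟨zero_mem _, fun t => by simp [one_mem]⟩
  add_mem' := by
    rintro x y ⟨hx, hx'⟩ ⟨hy, hy'⟩
    refine ⟨add_mem hx hy, fun t => ?_⟩
    rw [smul_add]
    refine hG.mem_of_tendsto
      (tendsto_exp_mul_exp_pow (skewAdjoint.smul_mem t hx) (skewAdjoint.smul_mem t hy))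
      (Eventually.of_forall fun n => ?_)
    rw [smul_smul, smul_smul]
    exact pow_mem (mul_mem (hx' _) (hy' _)) n
  smul_mem' := by
    rintro c x ⟨hx, hx'⟩
    refine ⟨skewAdjoint.smul_mem c hx, fun t => ?_⟩
    rw [smul_smul]
    exact hx' _

theorem mem_tangentSpace {G : Submonoid A} {hG : IsClosed (G : Set A)} {x : A} :
    x ∈ tangentSpace G hG ↔ x ∈ skewAdjoint A ∧ ∀ t : ℝ, exp (t • x) ∈ G := Iff.rfl

theorem isClosed_tangentSpace (G : Submonoid A) (hG : IsClosed (G : Set A)) :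
    IsClosed (tangentSpace G hG : Set A) := by
  let _ := NormedAlgebra.restrictScalars ℚ ℂ A
  have h : (tangentSpace G hG : Set A) =
      {x | star x = -x} ∩ ⋂ t : ℝ, (fun x => exp (t • x)) ⁻¹' (G : Set A) := by
    ext x
    simp [mem_tangentSpace, skewAdjoint.mem_iff]
  rw [h]
  refine (isClosed_eq continuous_star continuous_neg).inter (isClosed_iInter fun t => ?_)
  exact hG.preimage (exp_continuous.comp (continuous_const_smul t))

theorem exp_conj_mem_tangentSpace {G : Submonoid A} {hG : IsClosed (G : Set A)} {x y : A}
    (hx : x ∈ tangentSpace G hG) (hy : y ∈ tangentSpace G hG) (t : ℝ) :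
    exp (t • x) * y * exp (t • (-x)) ∈ tangentSpace G hG := by
  let _ := NormedAlgebra.restrictScalars ℚ ℂ A
  have hstar : exp (t • (-x)) = star (exp (t • x)) := by
    rw [star_exp, star_smul, skewAdjoint.mem_iff.1 hx.1, star_trivial]
  obtain ⟨h1, h2⟩ := Unitary.mem_iff.1 (exp_real_smul_mem_unitary hx.1 t)
  refine ⟨?_, fun s => ?_⟩
  · rw [hstar]
    exact skewAdjoint.conjugate hy.1 _
  · let u : Aˣ := ⟨exp (t • x), exp (t • (-x)), by rw [hstar, h2], by rw [hstar, h1]⟩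
    have h := exp_units_conj u (s • y)
    simp only [mul_smul_comm, smul_mul_assoc] at h
    change exp (s • (exp (t • x) * y * exp (t • -x))) = _ at h
    rw [h]
    have hx' : exp (t • -x) ∈ G := by simpa using hx.2 (-t)
    exact mul_mem (mul_mem (hx.2 t) (hy.2 s)) hx'

/-- The tangent space is a Lie algebra: the commutator is the velocity at `0` of the curve
`t ↦ exp (t x) y exp (-t x)` in it. -/
theorem commutator_mem_tangentSpace {G : Submonoid A} {hG : IsClosed (G : Set A)} {x y : A}
    (hx : x ∈ tangentSpace G hG) (hy : y ∈ tangentSpace G hG) :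
    x * y - y * x ∈ tangentSpace G hG := by
  have hd : HasDerivAt (fun t : ℝ => exp (t • x) * y * exp (t • (-x))) (x * y - y * x) 0 := by
    have h := ((hasDerivAt_exp_smul_zero x).mul_const y).fun_mul (hasDerivAt_exp_smul_zero (-x))
    simpa [sub_eq_add_neg] using h
  refine (isClosed_tangentSpace G hG).mem_of_tendsto (hasDerivAt_iff_tendsto_slope.1 hd)
    (Eventually.of_forall fun t => ?_)
  rw [slope_def_module]
  exact Submodule.smul_mem _ _ (sub_mem (exp_conj_mem_tangentSpace hx hy t)
    (exp_conj_mem_tangentSpace hx hy 0))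

end TangentSpace

open Matrix

/-! ### Lie algebras of matrices containing gap-separating diagonals -/

section Generation

variable {ι : Type*} [DecidableEq ι]

/-- The skew-Hermitian matrix `z E_st - z̄ E_ts`. For `s = t` it is `2 i (Im z) E_ss`. -/
def skewUnit (s t : ι) (z : ℂ) : Matrix ι ι ℂ := single s t z - single t s (star z)

theorem skewUnit_swap (s t : ι) (z : ℂ) : skewUnit t s z = skewUnit s t (-star z) := by
  simp only [skewUnit, star_neg, star_star, ← single_neg]
  abel

theorem skewUnit_add (s t : ι) (z w : ℂ) :
    skewUnit s t (z + w) = skewUnit s t z + skewUnit s t w := by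
  simp only [skewUnit, star_add, single_add]
  abel

theorem skewUnit_ofReal_mul (s t : ι) (r : ℝ) (z : ℂ) :
    skewUnit s t (r * z) = r • skewUnit s t z := by
  simp [skewUnit, smul_sub, smul_single]

theorem skewUnit_self (s : ι) (z : ℂ) :
    skewUnit s s z = z.im • skewUnit s s Complex.I := by
  rw [← skewUnit_ofReal_mul, skewUnit, skewUnit, ← sub_eq_zero]
  ext u v
  simp only [Matrix.sub_apply, single_apply]
  split_ifs <;> simp [Complex.ext_iff]

/-- The diagonal matrix with purely imaginary entries `i d_s`. -/
def imagDiagonal (d : ι → ℝ) : Matrix ι ι ℂ := diagonal fun s => Complex.I * d s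

theorem imagDiagonal_mem_skewAdjoint (d : ι → ℝ) :
    imagDiagonal d ∈ skewAdjoint (Matrix ι ι ℂ) := by
  rw [skewAdjoint.mem_iff, imagDiagonal, star_eq_conjTranspose, diagonal_conjTranspose,
    diagonal_neg]
  congr 1
  ext
  simp

theorem star_apply_of_mem_skewAdjoint {κ : Type*} {M : Matrix κ κ ℂ}
    (hM : M ∈ skewAdjoint (Matrix κ κ ℂ))
    (s t : κ) : star (M s t) = -M t s := by
  rw [← conjTranspose_apply, ← star_eq_conjTranspose, skewAdjoint.mem_iff.1 hM, neg_apply]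

variable [Fintype ι]

theorem skewUnit_commutator {s t u : ι} (hst : s ≠ t) (htu : t ≠ u) (hsu : s ≠ u) (z w : ℂ) :
    skewUnit s t z * skewUnit t u w - skewUnit t u w * skewUnit s t z = skewUnit s u (z * w) := by
  simp [skewUnit, mul_sub, sub_mul, single_mul_single_of_ne, hst, htu, hsu, hst.symm, htu.symm,
    hsu.symm, mul_comm]

theorem skewUnit_one_commutator_I {s t : ι} (hst : s ≠ t) :
    skewUnit s t 1 * skewUnit s t Complex.I - skewUnit s t Complex.I * skewUnit s t 1 =
      skewUnit s s Complex.I - skewUnit t t Complex.I := by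
  simp [skewUnit, mul_sub, sub_mul, single_mul_single_of_ne, hst, hst.symm]
  abel

theorem sum_skewUnit {M : Matrix ι ι ℂ} (hM : M ∈ skewAdjoint (Matrix ι ι ℂ)) :
    ∑ s, ∑ t, skewUnit s t (M s t) = (2 : ℝ) • M := by
  simp only [skewUnit, star_apply_of_mem_skewAdjoint hM, ← single_neg, sub_neg_eq_add, Finset.sum_add_distrib]
  rw [Finset.sum_comm (f := fun s t => single t s (M t s)), ← matrix_eq_sum_single, two_smul]

theorem imagDiagonal_commutator_apply (d : ι → ℝ) (M : Matrix ι ι ℂ) (s t : ι) :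
    (imagDiagonal d * M - M * imagDiagonal d) s t = Complex.I * (d s - d t) * M s t := by
  simp [imagDiagonal, diagonal_mul, mul_diagonal]
  ring

/-- The operator `ad_d ^ 2 + c` acts entrywise, by the factor `c - (d u - d v) ^ 2`. -/
theorem hadamard_sq_gap_mem {L : Submodule ℝ (Matrix ι ι ℂ)}
    (hL : ∀ x ∈ L, ∀ y ∈ L, x * y - y * x ∈ L) {d : ι → ℝ} (hd : imagDiagonal d ∈ L) (c : ℝ)
    {M : Matrix ι ι ℂ} (hM : M ∈ L) :
    (Matrix.of fun u v => ((c - (d u - d v) ^ 2 : ℝ) : ℂ) * M u v) ∈ L := by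
  have h := add_mem (L.smul_mem c hM) (hL _ hd _ (hL _ hd _ hM))
  convert h using 1
  ext u v
  rw [Matrix.add_apply, imagDiagonal_commutator_apply, imagDiagonal_commutator_apply]
  simp
  linear_combination (-((d u : ℂ) - d v) ^ 2 * M u v) * Complex.I_sq

/-- A set of real diagonals separates gaps if every nontrivial gap `d s - d t` can be told apart,
up to sign, from the gap at any other pair of indices by some `d` in the set. -/
def SeparatesGaps (D : Set (ι → ℝ)) : Prop :=
  ∀ s t u v : ι, s ≠ t → (u, v) ≠ (s, t) → (u, v) ≠ (t, s) →
    ∃ d ∈ D, (d s - d t) ^ 2 ≠ (d u - d v) ^ 2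

/-- Entries away from the positions `(s, t)` and `(t, s)` are killed one at a time by operators
`ad_d ^ 2 + c`, which act entrywise by real factors symmetric in the two indices. -/
theorem exists_hadamard_mem_of_separatesGaps {L : Submodule ℝ (Matrix ι ι ℂ)}
    (hL : ∀ x ∈ L, ∀ y ∈ L, x * y - y * x ∈ L) {D : Set (ι → ℝ)} (hD : SeparatesGaps D)
    (hDL : ∀ d ∈ D, imagDiagonal d ∈ L) {M : Matrix ι ι ℂ} (hM : M ∈ L) {s t : ι} (hst : s ≠ t)
    (T : Finset (ι × ι)) (hT : ∀ p ∈ T, p ≠ (s, t) ∧ p ≠ (t, s)) :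
    ∃ g : ι → ι → ℝ, g s t ≠ 0 ∧ g t s = g s t ∧ (∀ p ∈ T, g p.1 p.2 = 0) ∧
      (Matrix.of fun u v => (g u v : ℂ) * M u v) ∈ L := by
  induction T using Finset.induction_on with
  | empty => exact ⟨fun _ _ => 1, by simp, rfl, by simp, by
      simpa using (show Matrix.of M ∈ L from hM)⟩
  | insert p T hp ih =>
    obtain ⟨g, hg1, hg2, hg3, hg4⟩ := ih fun q hq => hT q (Finset.mem_insert_of_mem hq)
    obtain ⟨hp1, hp2⟩ := hT p (Finset.mem_insert_self _ _)
    obtain ⟨d, hd, hgap⟩ := hD s t p.1 p.2 hst hp1 hp2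
    refine ⟨fun u v => ((d p.1 - d p.2) ^ 2 - (d u - d v) ^ 2) * g u v,
      mul_ne_zero (sub_ne_zero.2 hgap.symm) hg1, ?_, ?_, ?_⟩
    · simp only [hg2]
      ring
    · intro q hq
      rcases Finset.mem_insert.1 hq with rfl | hq
      · simp
      · simp [hg3 q hq]
    · convert hadamard_sq_gap_mem hL (hDL d hd) ((d p.1 - d p.2) ^ 2) hg4 using 1
      ext u v
      simp [mul_assoc]

/-- One edge of a skew-Hermitian element, once isolated, comes with its rotation by `i` under a
diagonal with nonzero gap, and the two span all phases over `ℝ`. -/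
theorem skewUnit_mem_of_apply_ne_zero {L : Submodule ℝ (Matrix ι ι ℂ)}
    (hL : ∀ x ∈ L, ∀ y ∈ L, x * y - y * x ∈ L) {D : Set (ι → ℝ)} (hD : SeparatesGaps D)
    (hDL : ∀ d ∈ D, imagDiagonal d ∈ L) {M : Matrix ι ι ℂ} (hM : M ∈ L)
    (hM' : M ∈ skewAdjoint (Matrix ι ι ℂ)) {s t : ι} (hst : s ≠ t) (h0 : M s t ≠ 0) (z : ℂ) :
    skewUnit s t z ∈ L := by
  have hM1 : skewUnit s t (M s t) ∈ L := by
    obtain ⟨g, hg1, hg2, hg3, hg4⟩ := exists_hadamard_mem_of_separatesGaps hL hD hDL hM hst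
      (Finset.univ.filter fun p => p ≠ (s, t) ∧ p ≠ (t, s)) (by simp)
    have h : (Matrix.of fun u v => (g u v : ℂ) * M u v) = g s t • skewUnit s t (M s t) := by
      ext u v
      by_cases h1 : (u, v) = (s, t)
      · obtain ⟨rfl, rfl⟩ := Prod.mk.inj h1
        simp [skewUnit, hst, hst.symm]
      by_cases h2 : (u, v) = (t, s)
      · obtain ⟨rfl, rfl⟩ := Prod.mk.inj h2
        rw [skewUnit, star_apply_of_mem_skewAdjoint hM']
        simp [hst, hst.symm, hg2]
      · have h3 := hg3 (u, v) (by simp only [Finset.mem_filter_univ]; exact ⟨h1, h2⟩)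
        rw [Prod.mk.injEq] at h1 h2
        have h1' : ¬(s = u ∧ t = v) := fun h => h1 ⟨h.1.symm, h.2.symm⟩
        have h2' : ¬(t = u ∧ s = v) := fun h => h2 ⟨h.1.symm, h.2.symm⟩
        simp only at h3
        simp [skewUnit, h1', h2', h3]
    rw [h] at hg4
    exact (Submodule.smul_mem_iff _ hg1).1 hg4
  have hM2 : skewUnit s t (Complex.I * M s t) ∈ L := by
    obtain ⟨d, hd, hgap⟩ := hD s t s s hst (by simp [hst]) (by simp [hst])
    have hgap' : d s - d t ≠ 0 := fun h => hgap (by simp [h])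
    have h : imagDiagonal d * skewUnit s t (M s t) - skewUnit s t (M s t) * imagDiagonal d
        = (d s - d t) • skewUnit s t (Complex.I * M s t) := by
      rw [← skewUnit_ofReal_mul]
      ext u v
      rw [imagDiagonal_commutator_apply]
      by_cases h1 : s = u ∧ t = v
      · obtain ⟨rfl, rfl⟩ := h1
        simp [skewUnit, hst, hst.symm]
        ring
      by_cases h2 : t = u ∧ s = v
      · obtain ⟨rfl, rfl⟩ := h2
        simp [skewUnit, hst, hst.symm]
        ring
      · simp [skewUnit, h1, h2]
    exact (Submodule.smul_mem_iff _ hgap').1 (h ▸ hL _ (hDL d hd) _ hM1)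
  have hz : z = ((z / M s t).re : ℂ) * M s t + ((z / M s t).im : ℂ) * (Complex.I * M s t) := by
    rw [← mul_assoc, ← add_mul, Complex.re_add_im, div_mul_cancel₀ _ h0]
  rw [hz, skewUnit_add, skewUnit_ofReal_mul, skewUnit_ofReal_mul]
  exact add_mem (L.smul_mem _ hM1) (L.smul_mem _ hM2)

/-- Commutators compose adjacent pairs of indices, so connectedness of the index graph spreads the
off-diagonal elements from the edges to all pairs. -/
theorem skewUnit_mem_of_connected {L : Submodule ℝ (Matrix ι ι ℂ)}
    (hL : ∀ x ∈ L, ∀ y ∈ L, x * y - y * x ∈ L) {D : Set (ι → ℝ)} (hD : SeparatesGaps D)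
    (hDL : ∀ d ∈ D, imagDiagonal d ∈ L) {H : Matrix ι ι ℂ} (hH : IsPathConnectedHamiltonian H)
    (hHL : Complex.I • H ∈ L) {s t : ι} (hst : s ≠ t) (z : ℂ) : skewUnit s t z ∈ L := by
  have hskew : Complex.I • H ∈ skewAdjoint (Matrix ι ι ℂ) :=
    IsSelfAdjoint.I_smul_mem_skewAdjoint (K := ℂ) hH.1
  have hadj : ∀ u v, (indexGraph H).Adj u v → ∀ w, skewUnit u v w ∈ L := by
    intro u v huv w
    obtain ⟨hne, h | h⟩ := (SimpleGraph.fromRel_adj _ _ _).1 huv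
    · exact skewUnit_mem_of_apply_ne_zero hL hD hDL hHL hskew hne (by simpa using h) w
    · rw [skewUnit_swap]
      exact skewUnit_mem_of_apply_ne_zero hL hD hDL hHL hskew hne.symm (by simpa using h) _
  have hreach : ∀ u, Relation.ReflTransGen (indexGraph H).Adj s u →
      s ≠ u → ∀ w, skewUnit s u w ∈ L := by
    intro u hu
    induction hu with
    | refl => exact fun h => absurd rfl h
    | @tail b c hb hbc ih =>
      intro hsc w
      by_cases hsb : s = b
      · exact hadj _ _ (hsb ▸ hbc) w
      · have h := hL _ (ih hsb w) _ (hadj _ _ hbc 1)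
        rwa [skewUnit_commutator hsb hbc.ne hsc, mul_one] at h
  exact hreach t ((SimpleGraph.reachable_iff_reflTransGen _ _).1 (hH.2.preconnected s t)) hst z

/-- The controllability criterion: a real Lie algebra of matrices containing the scalar `i`, a
gap-separating family of diagonals, and a path-connected Hamiltonian contains every skew-Hermitian
matrix. -/
theorem mem_of_mem_skewAdjoint {L : Submodule ℝ (Matrix ι ι ℂ)}
    (hL : ∀ x ∈ L, ∀ y ∈ L, x * y - y * x ∈ L) {D : Set (ι → ℝ)} (hD : SeparatesGaps D)
    (hDL : ∀ d ∈ D, imagDiagonal d ∈ L) (h1 : imagDiagonal (fun _ => 1) ∈ L)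
    {H : Matrix ι ι ℂ} (hH : IsPathConnectedHamiltonian H)
    (hHL : Complex.I • H ∈ L) {M : Matrix ι ι ℂ} (hM : M ∈ skewAdjoint (Matrix ι ι ℂ)) :
    M ∈ L := by
  have hoff : ∀ s t, s ≠ t → ∀ z, skewUnit s t z ∈ L := fun s t hst z =>
    skewUnit_mem_of_connected hL hD hDL hH hHL hst z
  have hdiff : ∀ s t, skewUnit s s Complex.I - skewUnit t t Complex.I ∈ L := by
    intro s t
    by_cases hst : s = t
    · simp [hst]
    · rw [← skewUnit_one_commutator_I hst]
      exact hL _ (hoff s t hst _) _ (hoff s t hst _)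
  -- Summing the differences over `t` leaves `card ι` copies of the element at `s`, up to a scalar.
  have hdiag : ∀ s, skewUnit s s Complex.I ∈ L := by
    intro s
    have hsum : ∑ t, skewUnit t t Complex.I = (2 : ℝ) • imagDiagonal (fun _ : ι => 1) := by
      rw [← sum_skewUnit (imagDiagonal_mem_skewAdjoint _)]
      refine Finset.sum_congr rfl fun t _ => ?_
      rw [Finset.sum_eq_single t]
      · simp [imagDiagonal]
      · intro u _ hu
        simp [imagDiagonal, diagonal_apply_ne _ hu.symm, skewUnit]
      · simp
    have h : (Fintype.card ι : ℝ) • skewUnit s s Complex.I =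
        ∑ t, (skewUnit s s Complex.I - skewUnit t t Complex.I) +
          (2 : ℝ) • imagDiagonal (fun _ : ι => 1) := by
      rw [Finset.sum_sub_distrib, hsum, sub_add_cancel]
      simp [Nat.cast_smul_eq_nsmul]
    have hcard : (Fintype.card ι : ℝ) ≠ 0 := by
      have : Nonempty ι := ⟨s⟩
      exact_mod_cast Fintype.card_ne_zero
    refine (Submodule.smul_mem_iff _ hcard).1 (h ▸ add_mem ?_ (L.smul_mem _ h1))
    exact sum_mem fun t _ => hdiff s t
  refine (Submodule.smul_mem_iff _ (two_ne_zero' ℝ)).1 (sum_skewUnit hM ▸ ?_)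
  refine sum_mem fun s _ => sum_mem fun t _ => ?_
  by_cases hst : s = t
  · subst hst
    rw [skewUnit_self]
    exact L.smul_mem _ (hdiag s)
  · exact hoff s t hst _

end Generation

/-! ### Unitary matrices as products of exponentials -/

section Unitary

open NormedSpace
open scoped Matrix.Norms.L2Operator

/-- Every unitary matrix is a phase times the exponential of a skew-Hermitian matrix: its spectrum
is finite, so some phase moves it away from `-1`, where the principal logarithm is defined. -/
theorem exists_unitary_eq_exp_mul_exp {ι : Type*} [Fintype ι] [DecidableEq ι]
    {U : Matrix ι ι ℂ} (hU : U ∈ unitary (Matrix ι ι ℂ)) :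
    ∃ x ∈ skewAdjoint (Matrix ι ι ℂ), ∃ y ∈ skewAdjoint (Matrix ι ι ℂ), U = exp x * exp y := by
  have hfin : (Complex.arg '' spectrum ℂ U).Finite := U.finite_spectrum.image _
  obtain ⟨θ, hθ, hθ'⟩ := (Set.Ioo_infinite (zero_lt_one' ℝ)).exists_notMem_finite hfin
  -- The phase `c` carries the value `exp (i θ)`, which is not an eigenvalue of `U`, to `-1`.
  set c : ℂ := Complex.exp ((Real.pi - θ : ℝ) * Complex.I) with hc
  have hc0 : c ≠ 0 := Complex.exp_ne_zero _
  have hcnorm : ‖c‖ = 1 := Complex.norm_exp_ofReal_mul_I _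
  have hcu : c • U ∈ unitary (Matrix ι ι ℂ) := by
    have hcc : star c * c = 1 := by
      rw [Complex.star_def, ← Complex.normSq_eq_conj_mul_self, Complex.normSq_eq_norm_sq, hcnorm]
      simp
    obtain ⟨h1, h2⟩ := Unitary.mem_iff.1 hU
    rw [Unitary.mem_iff]
    constructor
    · rw [star_smul, smul_mul_smul_comm, hcc, h1, one_smul]
    · rw [star_smul, smul_mul_smul_comm, mul_comm, hcc, h2, one_smul]
  have hspec : -1 ∉ spectrum ℂ (c • U) := by
    intro h
    apply hθ'
    have h' : (Units.mk0 c hc0)⁻¹ • (-1 : ℂ) ∈ spectrum ℂ U := by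
      have h2 := spectrum.smul_mem_smul_iff (s := -1) (a := c • U) (r := (Units.mk0 c hc0)⁻¹)
      rw [show (Units.mk0 c hc0)⁻¹ • c • U = U by
        rw [Units.smul_def, smul_smul]; simp [hc0]] at h2
      exact h2.2 h
    refine ⟨_, h', ?_⟩
    have hval : (Units.mk0 c hc0)⁻¹ • (-1 : ℂ) = Complex.exp (θ * Complex.I) := by
      rw [Units.smul_def, Units.val_inv_eq_inv_val, Units.val_mk0, smul_eq_mul, hc,
        ← Complex.exp_neg, ← Complex.exp_pi_mul_I, ← Complex.exp_add]
      congr 1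
      push_cast
      ring
    rw [hval, Complex.exp_mul_I, Complex.arg_cos_add_sin_mul_I]
    exact ⟨by linarith [Real.pi_pos, hθ.1], by linarith [Real.pi_gt_three, hθ.2]⟩
  have hlog := expUnitary_argSelfAdjoint (u := ⟨c • U, hcu⟩)
    ((Unitary.norm_sub_one_lt_two_iff hcu).2 hspec)
  have hlog' := congrArg Subtype.val hlog
  rw [selfAdjoint.expUnitary_coe] at hlog'
  refine ⟨imagDiagonal fun _ => θ - Real.pi, imagDiagonal_mem_skewAdjoint _, _,
    IsSelfAdjoint.I_smul_mem_skewAdjoint (K := ℂ)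
      (Unitary.argSelfAdjoint (⟨c • U, hcu⟩ : unitary (Matrix ι ι ℂ))).2, ?_⟩
  have hexp : exp (imagDiagonal fun _ : ι => θ - Real.pi) = c⁻¹ • (1 : Matrix ι ι ℂ) := by
    rw [imagDiagonal, exp_diagonal, smul_one_eq_diagonal]
    congr 1
    ext i
    rw [Pi.coe_exp, ← Complex.exp_eq_exp_ℂ, hc, ← Complex.exp_neg]
    congr 1
    push_cast
    ring
  change U = _ * exp (Complex.I • _)
  rw [hlog', hexp, smul_mul_assoc, one_mul, inv_smul_smul₀ hc0]

end Unitary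

/-! ### Spectra of the qubit Hamiltonians -/

section Qubits

variable {n : ℕ}

theorem tensor_apply (A : Fin n → Matrix (Fin 2) (Fin 2) ℂ) (s t : Bits n) :
    tensor A s t = ∏ j, A j (s j) (t j) := rfl

/-- The eigenvalues `±1` of `Z_k` on the computational basis, with `Z_0 = I`. -/
def spin (k : Fin (n + 1)) (s : Bits n) : ℝ :=
  Fin.cons (α := fun _ => ℝ) 1 (fun j => if s j = 0 then 1 else -1) k

theorem spin_zero (s : Bits n) : spin 0 s = 1 := rfl

theorem spin_succ (j : Fin n) (s : Bits n) : spin j.succ s = if s j = 0 then 1 else -1 := rfl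

theorem spin_injective {s t : Bits n} (h : ∀ k, spin k s = spin k t) : s = t := by
  funext j
  have hj := h j.succ
  rw [spin_succ, spin_succ] at hj
  split_ifs at hj <;> first | omega | norm_num at hj

theorem spin_eq_one_or (k : Fin (n + 1)) (s : Bits n) : spin k s = 1 ∨ spin k s = -1 := by
  refine Fin.cases (Or.inl rfl) (fun j => ?_) k
  rw [spin_succ]
  split_ifs <;> simp

theorem opZ_eq_diagonal (k : Fin (n + 1)) : opZ n k = diagonal fun s => (spin k s : ℂ) := by
  refine Fin.cases ?_ (fun j => ?_) k
  · simp [opZ, spin_zero]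
  · ext s t
    rw [show opZ n j.succ = onQubit j pauliZ from rfl, onQubit, tensor_apply]
    by_cases hst : s = t
    · subst hst
      rw [Finset.prod_eq_single j (fun i _ hi => by simp [Function.update_of_ne hi]) (by simp),
        Function.update_self, diagonal_apply_eq, spin_succ]
      generalize s j = b
      fin_cases b <;> simp [pauliZ]
    · obtain ⟨i, hi⟩ := Function.ne_iff.1 hst
      rw [diagonal_apply_ne _ hst]
      refine Finset.prod_eq_zero (Finset.mem_univ i) ?_
      by_cases hij : i = j
      · subst hij
        rw [Function.update_self]
        revert hi
        generalize s i = b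
        generalize t i = c
        fin_cases b <;> fin_cases c <;> simp [pauliZ]
      · rw [Function.update_of_ne hij, one_apply_ne hi]

/-- The energy of a basis state under `H_Z`. -/
def energy (β : Fin (n + 1) → Fin (n + 1) → ℝ) (s : Bits n) : ℝ :=
  ∑ k, ∑ l, β k l * (spin k s * spin l s)

theorem hamZ_eq_diagonal (β : Fin (n + 1) → Fin (n + 1) → ℝ) :
    hamZ β = diagonal fun s => (energy β s : ℂ) := by
  ext s t
  simp only [hamZ, opZ_eq_diagonal, diagonal_mul_diagonal, Matrix.sum_apply, Matrix.smul_apply]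
  by_cases hst : s = t
  · subst hst
    simp [energy]
  · simp [diagonal_apply_ne _ hst]

theorem energy_add (β β' : Fin (n + 1) → Fin (n + 1) → ℝ) (s : Bits n) :
    energy (β + β') s = energy β s + energy β' s := by
  simp [energy, add_mul, Finset.sum_add_distrib]

theorem energy_smul (r : ℝ) (β : Fin (n + 1) → Fin (n + 1) → ℝ) (s : Bits n) :
    energy (r • β) s = r * energy β s := by
  simp [energy, Finset.mul_sum, mul_assoc]

theorem energy_single (k l : Fin (n + 1)) (s : Bits n) :
    energy (fun i j => if i = k ∧ j = l then 1 else 0) s = spin k s * spin l s := by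
  simp [energy, ite_and]

/-- Equal gaps for all quadratic energies force equal pairs: a coordinate where `s` and `t` differ
has equal gaps only if `u` agrees with `s` and `v` with `t` there, and products with that coordinate
determine the sums `u + v`, hence all the other coordinates. -/
theorem eq_of_energy_gap_eq {s t u v : Bits n} (hst : s ≠ t)
    (h : ∀ β, energy β s - energy β t = energy β u - energy β v) : u = s ∧ v = t := by
  have hq : ∀ k l, spin k s * spin l s - spin k t * spin l t =
      spin k u * spin l u - spin k v * spin l v := fun k l => by
    simpa only [energy_single] using h fun i j => if i = k ∧ j = l then 1 else 0
  have hl : ∀ k, spin k s - spin k t = spin k u - spin k v := fun k => by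
    simpa [spin_zero] using hq 0 k
  obtain ⟨k, hk⟩ : ∃ k, spin k s ≠ spin k t := by
    by_contra! hall
    exact hst (spin_injective hall)
  have hsum : ∀ l, spin l s + spin l t = spin l u + spin l v := by
    intro l
    have h1 := hq k l
    have h2 := hl k
    rcases spin_eq_one_or k s with hs | hs <;> rcases spin_eq_one_or k t with ht | ht <;>
      rcases spin_eq_one_or k u with hu | hu <;> rcases spin_eq_one_or k v with hv | hv <;>
      rw [hs, ht] at hk <;> rw [hs, ht, hu, hv] at h1 h2 <;>
      first | exact absurd rfl hk | (norm_num at h2; done) | linarith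
  exact ⟨spin_injective fun l => by linarith [hl l, hsum l],
    spin_injective fun l => by linarith [hl l, hsum l]⟩

theorem separatesGaps_energy : SeparatesGaps (Set.range (energy (n := n))) := by
  intro s t u v hst h1 h2
  obtain ⟨β, hβ⟩ : ∃ β, energy β s - energy β t - (energy β u - energy β v) ≠ 0 := by
    by_contra! h
    obtain ⟨rfl, rfl⟩ := eq_of_energy_gap_eq hst fun β => sub_eq_zero.1 (h β)
    exact h1 rfl
  obtain ⟨β', hβ'⟩ : ∃ β, energy β s - energy β t - (energy β v - energy β u) ≠ 0 := by
    by_contra! h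
    obtain ⟨rfl, rfl⟩ := eq_of_energy_gap_eq hst fun β => sub_eq_zero.1 (h β)
    exact h2 rfl
  -- The two linear functionals do not vanish, and neither does their product on the span of
  -- `β` and `β'`.
  by_contra! hall
  have h : ∀ γ, (energy γ s - energy γ t - (energy γ u - energy γ v)) *
      (energy γ s - energy γ t - (energy γ v - energy γ u)) = 0 := fun γ => by
    linear_combination hall _ ⟨γ, rfl⟩
  have e1 := (mul_eq_zero.1 (h β)).resolve_left hβ
  have e2 := (mul_eq_zero.1 (h β')).resolve_right hβ'
  have e3 := h (β + β')
  simp only [energy_add] at e3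
  refine mul_ne_zero hβ hβ' ?_
  linear_combination e3 - (energy β s - energy β t - (energy β u - energy β v)
    + (energy β' s - energy β' t - (energy β' u - energy β' v))) * e1
    - (energy β' s - energy β' t - (energy β' v - energy β' u)) * e2

theorem onQubit_pauliX_isHermitian (k : Fin n) : (onQubit k pauliX).IsHermitian := by
  ext s t
  rw [conjTranspose_apply, onQubit, tensor_apply, tensor_apply, star_prod]
  refine Finset.prod_congr rfl fun j _ => ?_
  by_cases hj : j = k
  · subst hj
    rw [Function.update_self]
    generalize s j = b
    generalize t j = c
    fin_cases b <;> fin_cases c <;> simp [pauliX]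
  · rw [Function.update_of_ne hj, one_apply, one_apply]
    simp only [eq_comm, apply_ite star, star_one, star_zero]

theorem sumX_apply_update (s : Bits n) (k : Fin n) {b : Fin 2} (hb : s k ≠ b) :
    sumX n s (Function.update s k b) = 1 := by
  rw [sumX, Matrix.sum_apply, Finset.sum_eq_single k]
  · rw [onQubit, tensor_apply]
    refine Finset.prod_eq_one fun j _ => ?_
    by_cases hj : j = k
    · subst hj
      rw [Function.update_self, Function.update_self]
      revert hb
      generalize s j = a
      fin_cases a <;> fin_cases b <;> simp [pauliX]
    · simp [Function.update_of_ne hj]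
  · intro i _ hi
    rw [onQubit, tensor_apply]
    refine Finset.prod_eq_zero (Finset.mem_univ i) ?_
    rw [Function.update_self, Function.update_of_ne hi]
    generalize s i = a
    fin_cases a <;> simp [pauliX]
  · simp

/-- The index graph contains the hypercube: any bit string is reached from any other by setting
bits one at a time. -/
theorem isPathConnectedHamiltonian_sumX (n : ℕ) : IsPathConnectedHamiltonian (sumX n) := by
  refine ⟨?_, ?_⟩
  · rw [IsHermitian, sumX, conjTranspose_sum]
    exact Finset.sum_congr rfl fun k _ => onQubit_pauliX_isHermitian k
  · have hstep : ∀ (s : Bits n) (k : Fin n) (b : Fin 2),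
        (indexGraph (sumX n)).Reachable s (Function.update s k b) := by
      intro s k b
      by_cases hb : s k = b
      · rw [← hb, Function.update_eq_self]
      · refine SimpleGraph.Adj.reachable ((SimpleGraph.fromRel_adj _ _ _).2 ⟨?_, Or.inl ?_⟩)
        · intro h
          exact hb (by simpa using congrFun h k)
        · rw [sumX_apply_update s k hb]
          exact one_ne_zero
    have hpre : (indexGraph (sumX n)).Preconnected := by
      intro s t
      have h : ∀ T : Finset (Fin n),
          (indexGraph (sumX n)).Reachable s (T.piecewise t s) := by
        intro T
        induction T using Finset.induction_on with
        | empty => simp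
        | insert k T _ ih =>
          rw [Finset.piecewise_insert]
          exact ih.trans (hstep _ k _)
      simpa using h Finset.univ
    exact ⟨hpre⟩

end Qubits

/-! ### Density of the ansatz -/

section Ansatz

open NormedSpace
-- The operator norm turns the matrices into a C⋆-algebra without changing their topology.
open scoped Matrix.Norms.L2Operator

variable {n : ℕ}

theorem exp_smul_imagDiagonal_energy (H : Op n) (β : Fin (n + 1) → Fin (n + 1) → ℝ) (t : ℝ) :
    exp (t • imagDiagonal (energy β)) = layer H (-t • β, 0) := by
  rw [layer, hamZ_eq_diagonal]
  simp only [Complex.ofReal_zero, mul_zero, zero_smul, exp_zero, mul_one]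
  congr 1
  ext s s'
  by_cases h : s = s'
  · subst h
    simp only [imagDiagonal, Matrix.smul_apply, diagonal_apply_eq, energy_smul, Complex.real_smul,
      smul_eq_mul]
    push_cast
    ring
  · simp [imagDiagonal, diagonal_apply_ne _ h]

theorem exp_smul_I_smul (H : Op n) (t : ℝ) : exp (t • Complex.I • H) = layer H (0, -t) := by
  have h0 : hamZ (0 : Fin (n + 1) → Fin (n + 1) → ℝ) = 0 := by simp [hamZ]
  rw [layer, h0, smul_zero, exp_zero, one_mul]
  congr 1
  rw [← Complex.coe_smul, smul_smul]
  congr 1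
  push_cast
  ring

theorem layer_mem_unitary {H : Op n} (hH : H.IsHermitian)
    (θ : (Fin (n + 1) → Fin (n + 1) → ℝ) × ℝ) : layer H θ ∈ unitary (Op n) := by
  have h : layer H θ = exp ((-1 : ℝ) • imagDiagonal (energy θ.1)) *
      exp ((-θ.2) • Complex.I • H) := by
    rw [exp_smul_imagDiagonal_energy H, exp_smul_I_smul, layer, layer, layer]
    simp [hamZ]
  rw [h]
  exact mul_mem (exp_real_smul_mem_unitary (imagDiagonal_mem_skewAdjoint _) _)
    (exp_real_smul_mem_unitary (IsSelfAdjoint.I_smul_mem_skewAdjoint (K := ℂ) hH) _)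

/-- The monoid of all finite products of layers of the ansatz with mixer `H`. -/
noncomputable def layerMonoid (H : Op n) : Submonoid (Op n) := MonoidHom.mrange (FreeMonoid.lift (layer H))

theorem mem_layerMonoid_iff {H U : Op n} :
    U ∈ layerMonoid H ↔ ∃ θs : List ((Fin (n + 1) → Fin (n + 1) → ℝ) × ℝ),
      U = (θs.map (layer H)).prod :=
  ⟨fun ⟨θs, h⟩ => ⟨θs.toList, h ▸ FreeMonoid.lift_apply _ _⟩,
    fun ⟨θs, h⟩ => ⟨FreeMonoid.ofList θs, h ▸ FreeMonoid.lift_apply _ _⟩⟩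

theorem layer_mem_layerMonoid (H : Op n) (θ : (Fin (n + 1) → Fin (n + 1) → ℝ) × ℝ) :
    layer H θ ∈ layerMonoid H := mem_layerMonoid_iff.2 ⟨[θ], by simp⟩

theorem layerMonoid_le_unitary {H : Op n} (hH : H.IsHermitian) :
    layerMonoid H ≤ unitary (Op n) := by
  intro U hU
  obtain ⟨θs, rfl⟩ := mem_layerMonoid_iff.1 hU
  refine Submonoid.list_prod_mem _ fun V hV => ?_
  obtain ⟨θ, -, rfl⟩ := List.mem_map.1 hV
  exact layer_mem_unitary hH θ

theorem unitary_le_topologicalClosure_layerMonoid {H : Op n} (hH : IsPathConnectedHamiltonian H) :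
    unitary (Op n) ≤ (layerMonoid H).topologicalClosure := by
  have hcl := (layerMonoid H).isClosed_topologicalClosure
  have hmem : ∀ θ, layer H θ ∈ (layerMonoid H).topologicalClosure := fun θ =>
    (layerMonoid H).le_topologicalClosure (layer_mem_layerMonoid H θ)
  have henergy : ∀ β, imagDiagonal (energy β) ∈ tangentSpace _ hcl := fun β =>
    ⟨imagDiagonal_mem_skewAdjoint _, fun t => exp_smul_imagDiagonal_energy H β t ▸ hmem _⟩
  have hone : imagDiagonal (fun _ : Bits n => 1) ∈ tangentSpace _ hcl := by
    convert henergy fun i j => if i = 0 ∧ j = 0 then 1 else 0 using 2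
    ext s
    rw [energy_single, spin_zero, mul_one]
  have hIH : Complex.I • H ∈ tangentSpace _ hcl :=
    ⟨IsSelfAdjoint.I_smul_mem_skewAdjoint (K := ℂ) hH.1, fun t => exp_smul_I_smul H t ▸ hmem _⟩
  have hall : ∀ x ∈ skewAdjoint (Op n), exp x ∈ (layerMonoid H).topologicalClosure := by
    intro x hx
    have h := mem_of_mem_skewAdjoint (fun x hx y hy => commutator_mem_tangentSpace hx hy)
      separatesGaps_energy (Set.forall_mem_range.2 henergy) hone hH hIH hx
    simpa using h.2 1
  intro U hU
  obtain ⟨x, hx, y, hy, rfl⟩ := exists_unitary_eq_exp_mul_exp hU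
  exact mul_mem (hall x hx) (hall y hy)

theorem dense_ansatz {H : Op n} (hH : IsPathConnectedHamiltonian H) : Dense (ansatz H) := by
  intro U
  rw [closure_subtype]
  have himg : Subtype.val '' ansatz H = (layerMonoid H : Set (Op n)) := by
    ext V
    constructor
    · rintro ⟨V, hV, rfl⟩
      exact mem_layerMonoid_iff.2 hV
    · intro hV
      exact ⟨⟨V, layerMonoid_le_unitary hH.1 hV⟩, mem_layerMonoid_iff.1 hV, rfl⟩
  rw [himg]
  exact unitary_le_topologicalClosure_layerMonoid hH U.2

end Ansatz

end QAOA

theorem mainTheorem4 (n : ℕ) (H : QAOA.Op n)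
    (hH : H = QAOA.sumX n ∨ QAOA.IsPathConnectedHamiltonian H) :
    Dense (QAOA.ansatz H) := by
  rcases hH with rfl | hH
  · exact QAOA.dense_ansatz (QAOA.isPathConnectedHamiltonian_sumX n)
  · exact QAOA.dense_ansatz hH
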